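/- Consider a queue with Poisson arrivals of rate $\lambda>0$, an infinite waiting room, and $K$ groups of parallel exponential servers; group $k$ has $M_k$ servers, each with service rate $\mu_k>0$ and operating cost rate $c_k\ge 0$ while turned on. Customers may migrate freely between servers, and turning servers on and off costs nothing. The state is the number $n\in\mathbb N$ of customers in the system, and $h(n)$ is the holding cost rate, where $h:\mathbb N\to\mathbb R$ is nondecreasing and convex with $h(n)\to\infty$. An efficient stationary policy $d$ assigns to every state $n$ a vector $d(n)=(d(n,1),\dots,d(n,K))$ of integers $0\le d(n,k)\le M_k$ with $\sum_k d(n,k)\le n$, the numbers of working servers. Under $d$ the number $n_t$ of customers at time $t$ is a birth-death process with birth rate $\lambda$ and death rate $\sum_k d(n,k)\mu_k$ in state $n$; denote its generator by $B$. The cost rate in state $n$ is $f(n,d(n))=h(n)+\sum_k d(n,k)c_k$, and the long-run average cost is $\eta^d=\lim_{T\to\infty}\mathbb E\{\frac1T\int_0^T f(n_t,d(n_t))\,dt\}$. Let $d^*$ be an optimal policy, that is, one that minimizes $\eta^d$ over all efficient policies, and suppose that $\eta^*=\eta^{d^*}$ is finite. Let $g^*$ be the performance potential of $d^*$, that is,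 $g^*(n)=\lim_{T\to\infty}\mathbb E\{\int_0^T [f(n_t,d^*(n_t))-\eta^*]\,dt \mid n_0=n\}$ if these limits exist and are finite for all $n$, or, more generally, any solution $g^*:\mathbb N\to\mathbb R$ of the Poisson equation $f(n,d^*(n))-\eta^*+\sum_{m}B(n,m)g^*(m)=0$, $n\in\mathbb N$. Then the perturbation realization factor $G^*(n)=g^*(n)-g^*(n-1)$, $n\ge1$, is nonnegative and nondecreasing in $n$: $G^*(n)\ge 0$ and $G^*(n+1)\ge G^*(n)$ for all $n\ge1$. -/

import Mathlib

noncomputable section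

/-- A group-server queue with `K` groups of parallel exponential servers: Poisson arrivals with rate
`arr`; group `k` consists of `M k` servers, each with service rate `mu k` and with operating cost
rate `c k` while it is on; `h n` is the holding cost rate with `n` customers in the system, which is
increasing, convex and unbounded.  Switching servers on and off costs nothing. -/
structure GroupServerQueue (K : ℕ) where
  arr : ℝ
  M : Fin K → ℕ
  mu : Fin K → ℝ
  c : Fin K → ℝ
  h : ℕ → ℝ
  arr_pos : 0 < arr
  mu_pos : ∀ k, 0 < mu k
  c_nonneg : ∀ k, 0 ≤ c k
  h_mono : Monotone h
  h_convex : ∀ n, h (n + 1) - h n ≤ h (n + 2) - h (n + 1)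
  h_tendsto : Filter.Tendsto h Filter.atTop Filter.atTop

namespace GroupServerQueue

variable {K : ℕ} (q : GroupServerQueue K)

/-- A stationary policy `d` (with `d n k` servers of group `k` on in state `n`) is efficient if in
every state it respects the group sizes and turns on no more servers than there are customers. -/
def IsEfficient (d : ℕ → Fin K → ℕ) : Prop :=
  ∀ n, (∀ k, d n k ≤ q.M k) ∧ ∑ k, d n k ≤ n

/-- Total service rate of the action `m`. -/
def serviceRate (m : Fin K → ℕ) : ℝ := ∑ k, (m k : ℝ) * q.mu k

/-- Total cost rate in state `n` under the action `m`: holding cost plus operating cost. -/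
def costRate (n : ℕ) (m : Fin K → ℕ) : ℝ := q.h n + ∑ k, (m k : ℝ) * q.c k

/-- Generator of the birth-death process of the number of customers under the policy `d`.
(For an efficient policy the service rate in state `0` is `0`.) -/
def generator (d : ℕ → Fin K → ℕ) (n m : ℕ) : ℝ :=
  if m = n + 1 then q.arr
  else if m + 1 = n then q.serviceRate (d n)
  else if m = n then -(q.arr + q.serviceRate (d n))
  else 0

/-- A bound on the total transition rate out of any state, valid under every efficient policy. -/
def maxRate : ℝ := q.arr + ∑ k, (q.M k : ℝ) * q.mu k

/-- Transition probabilities `I + B / Λ` of the uniformized chain, where `B` is the generator and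
`Λ` is the bound on the rates. -/
def unifStep (d : ℕ → Fin K → ℕ) (n m : ℕ) : ℝ :=
  (if n = m then 1 else 0) + q.generator d n m / q.maxRate

/-- Entries of the `j`-th power of the uniformized transition matrix (row `n` of the matrix vanishes
beyond column `n + 1`, so the matrix product is a finite sum). -/
def unifPow (d : ℕ → Fin K → ℕ) : ℕ → ℕ → ℕ → ℝ
  | 0, n, m => if n = m then 1 else 0
  | j + 1, n, m => ∑ l ∈ Finset.range (n + 2), q.unifStep d n l * unifPow d j l m

/-- Transition function `P(n_t = m | n_0 = n)` of the continuous-time Markov chain with generator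
`B`, i.e. the entry of `exp (t B) = ∑ j, e^{-Λ t} (Λ t)^j / j! (I + B / Λ)^j`. -/
def transProb (d : ℕ → Fin K → ℕ) (t : ℝ) (n m : ℕ) : ℝ :=
  ∑' j : ℕ, Real.exp (-(q.maxRate * t)) * (q.maxRate * t) ^ j / (j.factorial : ℝ)
    * q.unifPow d j n m

/-- Expected cost rate at time `t` from the initial state `n`: `E[f(n_t, d(n_t)) | n_0 = n]`. -/
def expCost (d : ℕ → Fin K → ℕ) (t : ℝ) (n : ℕ) : ℝ :=
  ∑' m : ℕ, q.transProb d t n m * q.costRate m (d m)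

/-- The policy `d` has the finite long-run average cost
`η = lim_{T → ∞} E[(1 / T) ∫_0^T f(n_t, d(n_t)) dt]`, from every initial state; the expectations are
required to be finite. -/
def HasAverageCost (d : ℕ → Fin K → ℕ) (η : ℝ) : Prop :=
  ∀ n : ℕ,
    (∀ t : ℝ, 0 ≤ t → Summable fun m : ℕ => q.transProb d t n m * q.costRate m (d m)) ∧
    (∀ T : ℝ, 0 ≤ T →
      IntervalIntegrable (fun t => q.expCost d t n) MeasureTheory.volume 0 T) ∧
    Filter.Tendsto (fun T : ℝ => (1 / T) * ∫ t in (0 : ℝ)..T, q.expCost d t n)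
      Filter.atTop (nhds η)

/-- `d` is an optimal policy, with the finite optimal long-run average cost `η`.  (An efficient
policy without a finite average cost has average cost `+∞` and is no better.) -/
def IsOptimal (d : ℕ → Fin K → ℕ) (η : ℝ) : Prop :=
  q.IsEfficient d ∧ q.HasAverageCost d η ∧
    ∀ (d' : ℕ → Fin K → ℕ) (η' : ℝ), q.IsEfficient d' → q.HasAverageCost d' η' → η ≤ η'

/-- `g` is the performance potential of the policy `d` with average cost `η`:
`g n = E[∫_0^∞ (f(n_t, d(n_t)) - η) dt | n_0 = n]`, the limit as `T → ∞` of the expected integral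
over `[0, T]`. -/
def IsPotential (d : ℕ → Fin K → ℕ) (η : ℝ) (g : ℕ → ℝ) : Prop :=
  ∀ n : ℕ, Filter.Tendsto (fun T : ℝ => ∫ t in (0 : ℝ)..T, (q.expCost d t n - η))
    Filter.atTop (nhds (g n))

/-- `g` is a relative value function of the policy `d` with average cost `η`: a solution of the
Poisson equation `f - η 1 + B g = 0` (row `n` of `B` vanishes beyond column `n + 1`). -/
def SolvesPoisson (d : ℕ → Fin K → ℕ) (η : ℝ) (g : ℕ → ℝ) : Prop :=
  ∀ n : ℕ, q.costRate n (d n) - η + ∑ m ∈ Finset.range (n + 2), q.generator d n m * g m = 0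

/-- The perturbation realization factor `G n = g n - g (n - 1)`; it is meant for `n ≥ 1` only. -/
def prf (g : ℕ → ℝ) (n : ℕ) : ℝ := g n - g (n - 1)

end GroupServerQueue

end


/-!
The Poisson equation is a recursion for `G = prf g`: if `R a x = ∑ k, a k * (mu k * x - c k)` is the
reward of the action `a` when services earn `x`, then `arr * G (n + 1) = η - h n + R (d n) (G n)`.
Changing an optimal policy in the single state `n` changes its stationary cost by a positive
multiple of `R (d n) (G n) - R a (G n)`, so that `R (d n) (G n)` is the maximum over all actions
allowed in the state `n`. Moving one server from a state `m + 1` to a state `n + 1 ≤ m + 1` gives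
`max R (m + 1) x - max R m x ≤ max R (n + 1) y - max R n y` for `x ≤ y`; together with the convexity
of `h` this makes every step of `G` after a first descent at least as steep as that descent, and `G`
tends to `-∞`. But the stationary cost above a level `n` with `η ≤ h n` is nonnegative, and it is a
positive multiple of `G (n + 1)`. So `G` never descends from `G 0 = 0`.

Stationary weights come from limits of the time averages of the transition probabilities. That they
charge all states follows from optimality: a policy idling in the presence of customers is improved
by the server with the least operating cost per service.
-/

open Filter Topology Finset

/-! ### Series, integrals and recursions on the real line -/

theorem exists_hasSum_le_of_sum_range_le {u : ℕ → ℝ} {c : ℝ} {N : ℕ} (hu : ∀ m, N ≤ m → 0 ≤ u m)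
    (h : ∀ M, N ≤ M → ∑ m ∈ range M, u m ≤ c) : ∃ S ≤ c, HasSum u S := by
  have hs : Summable u := by
    rw [← summable_nat_add_iff N]
    refine summable_of_sum_range_le (c := c - ∑ m ∈ range N, u m)
      (fun m => hu _ (Nat.le_add_left N m)) fun M => ?_
    have hM := h (N + M) (Nat.le_add_right N M)
    rw [sum_range_add] at hM
    simp only [add_comm N] at hM
    linarith
  exact ⟨_, le_of_tendsto hs.hasSum.tendsto_sum_nat (eventually_atTop.2 ⟨N, h⟩), hs.hasSum⟩

theorem hasSum_of_eqOn_Ici {u v : ℕ → ℝ} {S : ℝ} (hu : HasSum u S) {n : ℕ}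
    (h : ∀ m, n ≤ m → v m = u m) : HasSum v (S + ∑ m ∈ range n, (v m - u m)) := by
  have hdiff : HasSum (fun m => v m - u m) (∑ m ∈ range n, (v m - u m)) :=
    hasSum_sum_of_ne_finset_zero fun m hm => sub_eq_zero.2 (h m (not_lt.1 (mt mem_range.2 hm)))
  exact (hu.add hdiff).congr_fun fun m => (add_sub_cancel _ _).symm

theorem eq_zero_of_tendsto_of_tendsto_integral {u : ℝ → ℝ} {x I : ℝ}
    (hu : ∀ T, 0 ≤ T → IntervalIntegrable u MeasureTheory.volume 0 T)
    (hI : Tendsto (fun T => ∫ t in (0 : ℝ)..T, u t) atTop (𝓝 I)) (hx : Tendsto u atTop (𝓝 x)) :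
    x = 0 := by
  have hwindow : ∀ T, 0 ≤ T → (∫ t in (0 : ℝ)..(T + 1), u t) - ∫ t in (0 : ℝ)..T, u t
      = ∫ t in T..(T + 1), u t := fun T hT =>
    intervalIntegral.integral_interval_sub_left (hu _ (by positivity)) (hu _ hT)
  have hlim_zero : Tendsto (fun T : ℝ => ∫ t in T..(T + 1), u t) atTop (𝓝 0) := by
    have h := (hI.comp (tendsto_atTop_add_const_right atTop (1 : ℝ) tendsto_id)).sub hI
    rw [sub_self] at h
    refine h.congr' ?_
    filter_upwards [eventually_ge_atTop 0] with T hT using hwindow T hT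
  have hlim_x : Tendsto (fun T : ℝ => ∫ t in T..(T + 1), u t) atTop (𝓝 x) := by
    refine Metric.tendsto_nhds.2 fun ε hε => ?_
    obtain ⟨N, hN⟩ := Metric.tendsto_atTop.1 hx (ε / 2) (half_pos hε)
    filter_upwards [eventually_ge_atTop (max N 0)] with T hT
    have hT0 : 0 ≤ T := (le_max_right _ _).trans hT
    have hi : IntervalIntegrable u MeasureTheory.volume T (T + 1) :=
      (hu T hT0).symm.trans (hu (T + 1) (by positivity))
    have hnorm := intervalIntegral.norm_integral_le_of_norm_le_const
      (a := T) (b := T + 1) (f := fun t => u t - x) (C := ε / 2) fun t ht => by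
        rw [Set.uIoc_of_le (by linarith)] at ht
        exact (hN t (((le_max_left _ _).trans hT).trans ht.1.le)).le
    rw [intervalIntegral.integral_sub hi intervalIntegrable_const] at hnorm
    simp only [intervalIntegral.integral_const, add_sub_cancel_left, one_smul, abs_one,
      mul_one] at hnorm
    exact hnorm.trans_lt (half_lt_self hε)
  exact tendsto_nhds_unique hlim_x hlim_zero

theorem not_bddBelow_of_succ_sub_le {u : ℕ → ℝ} {δ : ℝ} (hδ : δ < 0)
    (hu : ∀ j, u (j + 1) - u j ≤ δ) : ¬ BddBelow (Set.range u) := by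
  rintro ⟨C, hC⟩
  have hlinear : ∀ j : ℕ, u j ≤ u 0 + j * δ := by
    intro j
    induction j with
    | zero => simp
    | succ j ih =>
      push_cast
      linarith [hu j]
  obtain ⟨j, hj⟩ := exists_nat_gt ((u 0 - C) / -δ)
  rw [div_lt_iff₀ (neg_pos.2 hδ)] at hj
  linarith [hlinear j, hC (Set.mem_range_self j)]

-- After the first descent every further step descends at least as much, so the orbit diverges.
theorem monotone_of_recursion {φ : ℕ → ℝ → ℝ} {u : ℕ → ℝ} (hu : ∀ n, u (n + 1) = φ n (u n))
    (hφ : ∀ n, Monotone (φ n))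
    (hincr : ∀ {n m x y}, n ≤ m → x ≤ y → φ (m + 1) x - φ m x ≤ φ (n + 1) y - φ n y)
    (h01 : u 0 ≤ u 1) (hbdd : BddBelow (Set.range u)) : Monotone u := by
  classical
  refine monotone_nat_of_le_succ fun i => ?_
  by_contra! hi
  have hex : ∃ i, u (i + 1) < u i := ⟨i, hi⟩
  obtain ⟨n, hn⟩ : ∃ n, Nat.find hex = n + 1 :=
    Nat.exists_eq_succ_of_ne_zero fun h => (h ▸ Nat.find_spec hex).not_ge h01
  have hdesc : u (n + 2) < u (n + 1) := by simpa only [hn] using Nat.find_spec hex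
  have hasc : u n ≤ u (n + 1) := not_lt.1 (Nat.find_min hex (by omega))
  have hstep : ∀ m, n ≤ m → u (m + 1) ≤ u m → u (m + 1) ≤ u (n + 1) →
      u (m + 2) - u (m + 1) ≤ u (n + 2) - u (n + 1) := by
    intro m hnm hm hmn
    calc u (m + 2) - u (m + 1) = φ (m + 1) (u (m + 1)) - φ m (u m) := by rw [hu, hu m]
      _ ≤ φ (m + 1) (u (m + 1)) - φ m (u (m + 1)) := sub_le_sub_left (hφ m hm) _
      _ ≤ φ (n + 1) (u (n + 1)) - φ n (u (n + 1)) := hincr hnm hmn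
      _ ≤ φ (n + 1) (u (n + 1)) - φ n (u n) := sub_le_sub_left (hφ n hasc) _
      _ = u (n + 2) - u (n + 1) := by rw [← hu, ← hu n]
  have hsteep : ∀ j : ℕ, u (n + 1 + j) ≤ u (n + 1) ∧
      u (n + 1 + (j + 1)) - u (n + 1 + j) ≤ u (n + 2) - u (n + 1) := by
    intro j
    induction j with
    | zero => exact ⟨le_rfl, le_rfl⟩
    | succ j ih =>
      have hdown : u (n + 1 + (j + 1)) ≤ u (n + 1 + j) := by linarith [ih.2]
      exact ⟨hdown.trans ih.1, hstep (n + 1 + j) (by omega) hdown (hdown.trans ih.1)⟩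
  exact not_bddBelow_of_succ_sub_le (u := fun j => u (n + 1 + j)) (sub_neg.2 hdesc)
    (fun j => (hsteep j).2) (hbdd.mono (Set.range_comp_subset_range (fun j => n + 1 + j) u))

/-! ### Poisson means -/

/-- The mean of the sequence `a` under the Poisson distribution with parameter `x`.  The series is
also used for negative `x`, so that the mean is a differentiable function on the whole line. -/
noncomputable def poissonMean (a : ℕ → ℝ) (x : ℝ) : ℝ :=
  ∑' j : ℕ, Real.exp (-x) * x ^ j / (j.factorial : ℝ) * a j

section PoissonMean

variable {a : ℕ → ℝ} {C : ℝ}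

theorem summable_pow_div_factorial_mul (ha : ∀ j, |a j| ≤ C) (x : ℝ) :
    Summable fun j : ℕ => x ^ j / (j.factorial : ℝ) * a j := by
  refine Summable.of_norm_bounded ((Real.summable_pow_div_factorial |x|).mul_right C) fun j => ?_
  rw [norm_mul, norm_div, norm_pow, Real.norm_eq_abs, Real.norm_eq_abs, Real.norm_eq_abs,
    Nat.abs_cast]
  exact mul_le_mul_of_nonneg_left (ha j) (by positivity)

theorem succ_mul_pow_div_factorial_succ (x : ℝ) (j : ℕ) :
    ((j + 1 : ℕ) : ℝ) * x ^ (j + 1 - 1) / ((j + 1).factorial : ℝ) = x ^ j / (j.factorial : ℝ) := by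
  rw [Nat.factorial_succ, Nat.add_sub_cancel, Nat.cast_mul,
    mul_div_mul_left _ _ (Nat.cast_ne_zero.2 j.succ_ne_zero)]

theorem hasDerivAt_tsum_pow_div_factorial_mul (ha : ∀ j, |a j| ≤ C) (x : ℝ) :
    HasDerivAt (fun x => ∑' j : ℕ, x ^ j / (j.factorial : ℝ) * a j)
      (∑' j : ℕ, x ^ j / (j.factorial : ℝ) * a (j + 1)) x := by
  set R := |x| + 1 with hR
  have hR0 : 0 < R := by positivity
  have hmajorant : Summable fun j : ℕ => j * R ^ (j - 1) / (j.factorial : ℝ) * C := by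
    rw [← summable_nat_add_iff 1]
    simp only [succ_mul_pow_div_factorial_succ]
    exact (Real.summable_pow_div_factorial R).mul_right C
  have hderiv := hasDerivAt_tsum_of_isPreconnected (𝕜 := ℝ)
    (g := fun (j : ℕ) (x : ℝ) => x ^ j / (j.factorial : ℝ) * a j)
    (g' := fun (j : ℕ) (x : ℝ) => j * x ^ (j - 1) / (j.factorial : ℝ) * a j)
    (t := Metric.ball 0 R) (y₀ := 0) (y := x) hmajorant Metric.isOpen_ball
    (convex_ball (0 : ℝ) R).isPreconnected
    (fun j y _ => ((hasDerivAt_pow j y).div_const _).mul_const _)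
    (fun j y hy => by
      have hy' : |y| ≤ R := by simpa using (mem_ball_zero_iff.1 hy).le
      rw [norm_mul, norm_div, norm_mul, norm_pow, Real.norm_eq_abs, Real.norm_eq_abs,
        Real.norm_eq_abs, Real.norm_eq_abs, Nat.abs_cast, Nat.abs_cast]
      have haj := ha j
      gcongr)
    (Metric.mem_ball_self hR0) (summable_pow_div_factorial_mul ha 0) (by simp [hR])
  refine hderiv.congr_deriv ?_
  have hs : Summable fun j : ℕ => (j : ℝ) * x ^ (j - 1) / (j.factorial : ℝ) * a j := by
    rw [← summable_nat_add_iff 1]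
    simp only [succ_mul_pow_div_factorial_succ]
    exact summable_pow_div_factorial_mul (fun j => ha (j + 1)) x
  rw [hs.tsum_eq_zero_add]
  simp only [succ_mul_pow_div_factorial_succ]
  simp

theorem poissonMean_eq_exp_mul_tsum (a : ℕ → ℝ) (x : ℝ) :
    poissonMean a x = Real.exp (-x) * ∑' j : ℕ, x ^ j / (j.factorial : ℝ) * a j := by
  rw [poissonMean, ← tsum_mul_left]
  exact tsum_congr fun j => by ring

theorem hasSum_poissonMean (ha : ∀ j, |a j| ≤ C) (x : ℝ) :
    HasSum (fun j : ℕ => Real.exp (-x) * x ^ j / (j.factorial : ℝ) * a j) (poissonMean a x) :=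
  (((summable_pow_div_factorial_mul ha x).mul_left (Real.exp (-x))).congr fun j => by
    ring).hasSum

theorem poissonMean_zero (a : ℕ → ℝ) : poissonMean a 0 = a 0 := by
  rw [poissonMean, tsum_eq_single 0 fun j hj => by simp [hj]]
  simp

theorem poissonMean_const (c x : ℝ) : poissonMean (fun _ => c) x = c := by
  have hexp : ∑' j : ℕ, x ^ j / (j.factorial : ℝ) = Real.exp x := by
    rw [Real.exp_eq_exp_ℝ, NormedSpace.exp_eq_tsum_div]
  rw [poissonMean_eq_exp_mul_tsum, tsum_mul_right, hexp, ← mul_assoc, ← Real.exp_add,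
    neg_add_cancel, Real.exp_zero, one_mul]

theorem poissonMean_mem_Icc {c : ℝ} (ha : ∀ j, a j ∈ Set.Icc c C) {x : ℝ} (hx : 0 ≤ x) :
    poissonMean a x ∈ Set.Icc c C := by
  have hsum := hasSum_poissonMean (fun j => abs_le_max_abs_abs (ha j).1 (ha j).2) x
  have hconst : ∀ c : ℝ, HasSum (fun j : ℕ => Real.exp (-x) * x ^ j / (j.factorial : ℝ) * c) c :=
    fun c => by
      simpa only [poissonMean_const] using hasSum_poissonMean (a := fun _ => c) (fun _ => le_rfl) x
  exact ⟨hasSum_le (fun j => mul_le_mul_of_nonneg_left (ha j).1 (by positivity)) (hconst c) hsum,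
    hasSum_le (fun j => mul_le_mul_of_nonneg_left (ha j).2 (by positivity)) hsum (hconst C)⟩

theorem poissonMean_sum_mul {ι : Type*} (s : Finset ι) (c : ι → ℝ) {a : ι → ℕ → ℝ}
    (ha : ∀ i j, |a i j| ≤ C) (x : ℝ) :
    poissonMean (fun j => ∑ i ∈ s, c i * a i j) x = ∑ i ∈ s, c i * poissonMean (a i) x := by
  refine HasSum.tsum_eq ((hasSum_sum fun i _ =>
    (hasSum_poissonMean (ha i) x).mul_left (c i)).congr_fun fun j => ?_)
  rw [mul_sum]
  exact sum_congr rfl fun i _ => mul_left_comm _ _ _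

theorem hasSum_poissonMean_of_hasSum {ι : Type*} {a : ℕ → ι → ℝ} {b : ℕ → ℝ}
    (ha : ∀ j i, 0 ≤ a j i) (hab : ∀ j, HasSum (a j) (b j)) (hb : ∀ j, b j ≤ C) {x : ℝ}
    (hx : 0 ≤ x) : HasSum (fun i => poissonMean (fun j => a j i) x) (poissonMean b x) := by
  have hb0 : ∀ j, 0 ≤ b j := fun j => (hab j).nonneg (ha j)
  have hle : ∀ i j, |a j i| ≤ C := fun i j => by
    rw [abs_of_nonneg (ha j i)]
    exact (le_hasSum (hab j) i fun i _ => ha j i).trans (hb j)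
  let w : ℕ → ℝ := fun j => Real.exp (-x) * x ^ j / (j.factorial : ℝ)
  have hw : ∀ j, 0 ≤ w j := fun j => by positivity
  have hmean := hasSum_poissonMean (fun j => (abs_of_nonneg (hb0 j)).trans_le (hb j)) x
  have hrow : ∀ j, HasSum (fun i => w j * a j i) (w j * b j) := fun j => (hab j).mul_left (w j)
  have hpair : Summable fun z : ℕ × ι => w z.1 * a z.1 z.2 :=
    (summable_prod_of_nonneg fun z => mul_nonneg (hw _) (ha _ _)).2
      ⟨fun j => (hrow j).summable, hmean.summable.congr fun j => (hrow j).tsum_eq.symm⟩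
  have htotal := hpair.hasSum.prod_fiberwise hrow |>.unique hmean
  have hswap := (Equiv.prodComm ι ℕ).hasSum_iff.2 (htotal ▸ hpair.hasSum)
  exact hswap.prod_fiberwise fun i => hasSum_poissonMean (hle i) x

theorem hasDerivAt_poissonMean (ha : ∀ j, |a j| ≤ C) (x : ℝ) :
    HasDerivAt (poissonMean a) (poissonMean (fun j => a (j + 1)) x - poissonMean a x) x := by
  rw [funext (poissonMean_eq_exp_mul_tsum a), poissonMean_eq_exp_mul_tsum]
  refine ((hasDerivAt_neg x).exp.mul (hasDerivAt_tsum_pow_div_factorial_mul ha x)).congr_deriv ?_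
  ring

theorem hasDerivAt_poissonMean_of_recursion {ι : Type*} (s : Finset ι) (c : ι → ℝ)
    {b : ι → ℕ → ℝ} (ha : ∀ j, |a j| ≤ C) (hb : ∀ i j, |b i j| ≤ C)
    (hab : ∀ j, a (j + 1) = ∑ i ∈ s, c i * b i j) (r t : ℝ) :
    HasDerivAt (fun t => poissonMean a (r * t))
      (r * (∑ i ∈ s, c i * poissonMean (b i) (r * t) - poissonMean a (r * t))) t := by
  have hderiv := (hasDerivAt_poissonMean ha (r * t)).comp t ((hasDerivAt_id t).const_mul r)
  refine hderiv.congr_deriv ?_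
  rw [funext hab, poissonMean_sum_mul s c hb]
  ring

end PoissonMean

namespace GroupServerQueue

variable {K : ℕ} {q : GroupServerQueue K} {d : ℕ → Fin K → ℕ}

/-! ### The generator and the transition function -/

theorem serviceRate_nonneg (q : GroupServerQueue K) (a : Fin K → ℕ) : 0 ≤ q.serviceRate a :=
  sum_nonneg fun k _ => mul_nonneg (Nat.cast_nonneg _) (q.mu_pos k).le

theorem serviceRate_zero (q : GroupServerQueue K) : q.serviceRate 0 = 0 := by
  simp [serviceRate]

theorem maxRate_pos (q : GroupServerQueue K) : 0 < q.maxRate :=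
  add_pos_of_pos_of_nonneg q.arr_pos (q.serviceRate_nonneg q.M)

theorem IsEfficient.serviceRate_le (hd : q.IsEfficient d) (n : ℕ) :
    q.serviceRate (d n) ≤ q.serviceRate q.M :=
  sum_le_sum fun k _ => mul_le_mul_of_nonneg_right (Nat.cast_le.2 ((hd n).1 k)) (q.mu_pos k).le

theorem IsEfficient.apply_zero (hd : q.IsEfficient d) : d 0 = 0 :=
  funext fun k => sum_eq_zero_iff.1 (Nat.le_zero.1 (hd 0).2) k (mem_univ k)

theorem IsEfficient.serviceRate_apply_zero (hd : q.IsEfficient d) : q.serviceRate (d 0) = 0 := by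
  rw [hd.apply_zero, serviceRate_zero]

theorem generator_eq_zero {n m : ℕ} (h : n + 1 < m ∨ m + 1 < n) : q.generator d n m = 0 := by
  rw [generator, if_neg (by omega), if_neg (by omega), if_neg (by omega)]

theorem unifStep_eq_zero {n m : ℕ} (h : n + 1 < m ∨ m + 1 < n) : q.unifStep d n m = 0 := by
  rw [unifStep, if_neg (by omega), generator_eq_zero h, zero_div, add_zero]

theorem IsEfficient.sum_generator_mul (hd : q.IsEfficient d) (u : ℕ → ℝ) (n : ℕ) :
    ∑ m ∈ range (n + 2), q.generator d n m * u m
      = q.arr * (u (n + 1) - u n) - q.serviceRate (d n) * (u n - u (n - 1)) := by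
  cases n with
  | zero =>
    simp [sum_range_succ, generator, hd.serviceRate_apply_zero]
    ring
  | succ n =>
    have hfar : ∑ m ∈ range n, q.generator d (n + 1) m * u m = 0 :=
      sum_eq_zero fun m hm => by
        rw [generator_eq_zero (.inr (Nat.succ_lt_succ (mem_range.1 hm))), zero_mul]
    rw [sum_range_succ, sum_range_succ, sum_range_succ, hfar]
    simp [generator, show n ≠ n + 1 + 1 by omega]
    ring

theorem IsEfficient.sum_generator (hd : q.IsEfficient d) (n : ℕ) :
    ∑ m ∈ range (n + 2), q.generator d n m = 0 := by
  simpa using hd.sum_generator_mul (fun _ => 1) n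

theorem IsEfficient.sum_sum_mul_generator (hd : q.IsEfficient d) (v : ℕ → ℝ) (m : ℕ) :
    ∑ i ∈ range (m + 1), ∑ l ∈ range (i + 2), v l * q.generator d l i
      = q.serviceRate (d (m + 1)) * v (m + 1) - q.arr * v m := by
  induction m with
  | zero =>
    simp [sum_range_succ, generator, hd.serviceRate_apply_zero]
    ring
  | succ m ih =>
    have hfar : ∑ l ∈ range m, v l * q.generator d l (m + 1) = 0 :=
      sum_eq_zero fun l hl => by
        rw [generator_eq_zero (.inl (Nat.succ_lt_succ (mem_range.1 hl))), mul_zero]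
    rw [sum_range_succ, ih, sum_range_succ, sum_range_succ, sum_range_succ, hfar]
    simp [generator]
    ring

theorem sum_unifStep_mul (q : GroupServerQueue K) (d : ℕ → Fin K → ℕ) (u : ℕ → ℝ) (n : ℕ) :
    ∑ m ∈ range (n + 2), q.unifStep d n m * u m
      = u n + (∑ m ∈ range (n + 2), q.generator d n m * u m) / q.maxRate := by
  simp only [unifStep, add_mul, sum_add_distrib, ite_mul, one_mul, zero_mul, sum_div,
    div_mul_eq_mul_div, sum_ite_eq, mem_range, Nat.lt_add_of_pos_right two_pos, if_true]

theorem sum_mul_unifStep (q : GroupServerQueue K) (d : ℕ → Fin K → ℕ) (v : ℕ → ℝ) (m : ℕ) :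
    ∑ l ∈ range (m + 2), v l * q.unifStep d l m
      = v m + (∑ l ∈ range (m + 2), v l * q.generator d l m) / q.maxRate := by
  simp only [unifStep, mul_add, sum_add_distrib, mul_ite, mul_one, mul_zero, sum_div,
    mul_div_assoc, sum_ite_eq', mem_range, Nat.lt_add_of_pos_right two_pos, if_true]

theorem IsEfficient.unifStep_nonneg (hd : q.IsEfficient d) (n m : ℕ) : 0 ≤ q.unifStep d n m := by
  have hΛ := q.maxRate_pos
  rcases eq_or_ne n m with rfl | hnm
  · have hrate : q.arr + q.serviceRate (d n) ≤ q.maxRate :=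
      add_le_add_right (hd.serviceRate_le n) _
    have hle := (div_le_one hΛ).2 hrate
    rw [unifStep, generator, if_pos rfl, if_neg (by omega), if_neg (by omega), if_pos rfl, neg_div,
      ← sub_eq_add_neg]
    exact sub_nonneg.2 hle
  · rw [unifStep, if_neg hnm, zero_add, generator, if_neg hnm.symm]
    have hserve := q.serviceRate_nonneg (d n)
    have harr := q.arr_pos
    split_ifs <;> positivity

theorem IsEfficient.unifPow_nonneg (hd : q.IsEfficient d) (j n m : ℕ) :
    0 ≤ q.unifPow d j n m := by
  induction j generalizing n with
  | zero => rw [unifPow]; split_ifs <;> norm_num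
  | succ j ih => exact sum_nonneg fun l _ => mul_nonneg (hd.unifStep_nonneg n l) (ih l)

theorem IsEfficient.hasSum_unifPow (hd : q.IsEfficient d) (j n : ℕ) :
    HasSum (fun m => q.unifPow d j n m) 1 := by
  induction j generalizing n with
  | zero => simpa [unifPow, eq_comm] using hasSum_ite_eq n (1 : ℝ)
  | succ j ih =>
    have hrow : ∑ l ∈ range (n + 2), q.unifStep d n l * 1 = 1 := by
      rw [sum_unifStep_mul q d (fun _ => 1) n]
      simp [hd.sum_generator]
    have hsum := hasSum_sum (s := range (n + 2)) fun l _ => (ih l).mul_left (q.unifStep d n l)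
    rwa [hrow] at hsum

theorem IsEfficient.abs_unifPow_le_one (hd : q.IsEfficient d) (j n m : ℕ) :
    |q.unifPow d j n m| ≤ 1 :=
  (abs_of_nonneg (hd.unifPow_nonneg j n m)).trans_le
    (le_hasSum (hd.hasSum_unifPow j n) m fun i _ => hd.unifPow_nonneg j n i)

theorem unifPow_succ' (j n m : ℕ) :
    q.unifPow d (j + 1) n m = ∑ l ∈ range (m + 2), q.unifPow d j n l * q.unifStep d l m := by
  induction j generalizing n with
  | zero =>
    simp only [unifPow, mul_ite, mul_one, mul_zero, ite_mul, one_mul, zero_mul, sum_ite_eq,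
      sum_ite_eq', mem_range]
    split_ifs with hm hn hn
    · rfl
    · exact unifStep_eq_zero (by omega)
    · exact (unifStep_eq_zero (by omega)).symm
    · rfl
  | succ j ih =>
    rw [unifPow]
    simp only [ih, mul_sum]
    rw [sum_comm]
    refine sum_congr rfl fun l _ => ?_
    rw [unifPow, sum_mul]
    exact sum_congr rfl fun i _ => (mul_assoc _ _ _).symm

theorem transProb_zero (n m : ℕ) : q.transProb d 0 n m = if n = m then 1 else 0 := by
  have hmean : q.transProb d 0 n m = poissonMean (fun j => q.unifPow d j n m) (q.maxRate * 0) := rfl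
  rw [hmean, mul_zero, poissonMean_zero, unifPow]

theorem IsEfficient.transProb_nonneg (hd : q.IsEfficient d) {t : ℝ} (ht : 0 ≤ t) (n m : ℕ) :
    0 ≤ q.transProb d t n m :=
  (poissonMean_mem_Icc
    (fun j => ⟨hd.unifPow_nonneg j n m, (abs_le.1 (hd.abs_unifPow_le_one j n m)).2⟩)
    (mul_nonneg q.maxRate_pos.le ht)).1

theorem IsEfficient.hasSum_transProb (hd : q.IsEfficient d) {t : ℝ} (ht : 0 ≤ t) (n : ℕ) :
    HasSum (fun m => q.transProb d t n m) 1 := by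
  have hsum := hasSum_poissonMean_of_hasSum (fun j m => hd.unifPow_nonneg j n m)
    (fun j => hd.hasSum_unifPow j n) (fun _ => le_rfl) (mul_nonneg q.maxRate_pos.le ht)
  rwa [poissonMean_const] at hsum

theorem IsEfficient.hasDerivAt_transProb_backward (hd : q.IsEfficient d) (t : ℝ) (n m : ℕ) :
    HasDerivAt (fun t => q.transProb d t n m)
      (∑ l ∈ range (n + 2), q.generator d n l * q.transProb d t l m) t := by
  refine (hasDerivAt_poissonMean_of_recursion (range (n + 2)) (q.unifStep d n)
    (fun j => hd.abs_unifPow_le_one j n m) (fun l j => hd.abs_unifPow_le_one j l m)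
    (fun _ => rfl) q.maxRate t).congr_deriv ?_
  change q.maxRate * (∑ l ∈ range (n + 2), q.unifStep d n l * q.transProb d t l m
    - q.transProb d t n m) = _
  rw [sum_unifStep_mul, add_sub_cancel_left, mul_div_cancel₀ _ q.maxRate_pos.ne']

theorem IsEfficient.hasDerivAt_transProb_forward (hd : q.IsEfficient d) (t : ℝ) (n m : ℕ) :
    HasDerivAt (fun t => q.transProb d t n m)
      (∑ l ∈ range (m + 2), q.transProb d t n l * q.generator d l m) t := by
  refine (hasDerivAt_poissonMean_of_recursion (range (m + 2)) (fun l => q.unifStep d l m)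
    (fun j => hd.abs_unifPow_le_one j n m) (fun l j => hd.abs_unifPow_le_one j n l)
    (fun j => by simp only [unifPow_succ' j, mul_comm]) q.maxRate t).congr_deriv ?_
  change q.maxRate * (∑ l ∈ range (m + 2), q.unifStep d l m * q.transProb d t n l
    - q.transProb d t n m) = _
  simp only [mul_comm (q.unifStep d _ m)]
  rw [sum_mul_unifStep, add_sub_cancel_left, mul_div_cancel₀ _ q.maxRate_pos.ne']

theorem IsEfficient.hasDerivAt_sum_transProb (hd : q.IsEfficient d) (t : ℝ) (n m : ℕ) :
    HasDerivAt (fun t => ∑ i ∈ range (m + 1), q.transProb d t n i)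
      (q.serviceRate (d (m + 1)) * q.transProb d t n (m + 1) - q.arr * q.transProb d t n m) t := by
  rw [← hd.sum_sum_mul_generator]
  exact HasDerivAt.fun_sum fun i _ => hd.hasDerivAt_transProb_forward t n i

theorem IsEfficient.continuous_transProb (hd : q.IsEfficient d) (n m : ℕ) :
    Continuous fun t => q.transProb d t n m :=
  continuous_iff_continuousAt.2 fun t => (hd.hasDerivAt_transProb_backward t n m).continuousAt

theorem IsEfficient.intervalIntegrable_transProb (hd : q.IsEfficient d) (n m : ℕ) (a b : ℝ) :
    IntervalIntegrable (fun t => q.transProb d t n m) MeasureTheory.volume a b :=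
  (hd.continuous_transProb n m).intervalIntegrable a b

/-! ### Balanced weights -/

/-- The weights `p` on the states are in detailed balance with the birth-death process of the
policy `d`: the flows between neighbouring states cancel, so `p` is invariant.  The weights need
not be normalized, nor nonnegative. -/
def Balanced (q : GroupServerQueue K) (d : ℕ → Fin K → ℕ) (p : ℕ → ℝ) : Prop :=
  ∀ m, q.arr * p m = q.serviceRate (d (m + 1)) * p (m + 1)

namespace Balanced

variable {p : ℕ → ℝ}

theorem sum_mul_generator (hp : q.Balanced d p) (hd : q.IsEfficient d) (m : ℕ) :
    ∑ l ∈ range (m + 2), p l * q.generator d l m = 0 := by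
  have hpartial : ∀ m, ∑ i ∈ range (m + 1), ∑ l ∈ range (i + 2), p l * q.generator d l i = 0 :=
    fun m => by rw [hd.sum_sum_mul_generator, ← hp m, sub_self]
  cases m with
  | zero => simpa using hpartial 0
  | succ m => simpa [sum_range_succ _ (m + 1), hpartial m] using hpartial (m + 1)

theorem mul_unifPow_le (hp : q.Balanced d p) (hd : q.IsEfficient d) (hp0 : ∀ m, 0 ≤ p m)
    (j n m : ℕ) : p n * q.unifPow d j n m ≤ p m := by
  induction j generalizing m with
  | zero =>
    rw [unifPow]
    split_ifs with h
    · rw [h, mul_one]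
    · rw [mul_zero]; exact hp0 m
  | succ j ih =>
    calc p n * q.unifPow d (j + 1) n m
        = ∑ l ∈ range (m + 2), p n * q.unifPow d j n l * q.unifStep d l m := by
          simp only [unifPow_succ', mul_sum, mul_assoc]
      _ ≤ ∑ l ∈ range (m + 2), p l * q.unifStep d l m :=
          sum_le_sum fun l _ => mul_le_mul_of_nonneg_right (ih l) (hd.unifStep_nonneg l m)
      _ = p m := by rw [sum_mul_unifStep, hp.sum_mul_generator hd, zero_div, add_zero]

theorem transProb_le (hp : q.Balanced d p) (hd : q.IsEfficient d) (hpos : ∀ m, 0 < p m) {t : ℝ}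
    (ht : 0 ≤ t) (n m : ℕ) : q.transProb d t n m ≤ p m / p n :=
  (poissonMean_mem_Icc (fun j => ⟨hd.unifPow_nonneg j n m,
    (le_div_iff₀' (hpos n)).2 (hp.mul_unifPow_le hd (fun m => (hpos m).le) j n m)⟩)
    (mul_nonneg q.maxRate_pos.le ht)).2

theorem serviceRate_pos (hp : q.Balanced d p) (hpos : ∀ m, 0 < p m) (m : ℕ) :
    0 < q.serviceRate (d (m + 1)) :=
  pos_of_mul_pos_left (by rw [← hp m]; exact mul_pos q.arr_pos (hpos m)) (hpos (m + 1)).le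

theorem mul_eq_mul (hp : q.Balanced d p) (hpos : ∀ m, 0 < p m) {p' : ℕ → ℝ}
    (hp' : q.Balanced d p') (m : ℕ) : p' m * p 0 = p' 0 * p m := by
  induction m with
  | zero => rfl
  | succ m ih =>
    refine mul_left_cancel₀ (hp.serviceRate_pos hpos m).ne' ?_
    calc q.serviceRate (d (m + 1)) * (p' (m + 1) * p 0) = q.arr * (p' m * p 0) := by
          rw [← mul_assoc, ← hp' m, mul_assoc]
      _ = p' 0 * (q.arr * p m) := by rw [ih, mul_left_comm]
      _ = q.serviceRate (d (m + 1)) * (p' 0 * p (m + 1)) := by rw [hp m, mul_left_comm]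

theorem hasSum_mul_serviceRate (hp : q.Balanced d p) (hd : q.IsEfficient d) {Z : ℝ}
    (hZ : HasSum p Z) : HasSum (fun m => p m * q.serviceRate (d m)) (q.arr * Z) := by
  rw [← hasSum_nat_add_iff' 1, sum_range_one, hd.serviceRate_apply_zero, mul_zero, sub_zero]
  exact (hZ.mul_left q.arr).congr_fun fun m => by rw [hp m, mul_comm]

theorem eq_zero_of_lt (hp : q.Balanced d p) {n : ℕ} (hn : q.serviceRate (d n) = 0) {m : ℕ}
    (hm : m < n) : p m = 0 := by
  have hdown : ∀ i, q.serviceRate (d (i + 1)) * p (i + 1) = 0 → p i = 0 := fun i hi =>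
    (mul_eq_zero.1 ((hp i).trans hi)).resolve_left q.arr_pos.ne'
  obtain ⟨n, rfl⟩ := Nat.exists_eq_succ_of_ne_zero (Nat.ne_zero_of_lt hm)
  induction Nat.le_of_lt_succ hm using Nat.decreasingInduction with
  | self => exact hdown n (by rw [hn, zero_mul])
  | of_succ i hi ih => exact hdown i (by rw [ih (Nat.succ_lt_succ hi), mul_zero])

theorem eq_zero_iff_of_le (hp : q.Balanced d p) {n : ℕ}
    (hserve : ∀ m, n < m → 0 < q.serviceRate (d m)) {m : ℕ} (hm : n ≤ m) :
    p m = 0 ↔ p n = 0 := by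
  induction m, hm using Nat.le_induction with
  | base => rfl
  | succ m hm ih =>
    rw [← ih, ← mul_eq_zero_iff_left (hserve (m + 1) (Nat.lt_succ_of_le hm)).ne', ← hp m,
      mul_eq_zero_iff_left q.arr_pos.ne']

theorem pos_of_le (hp : q.Balanced d p) (hp0 : ∀ m, 0 ≤ p m) (hne : ∃ m, 0 < p m) {n : ℕ}
    (hidle : q.serviceRate (d n) = 0) (hserve : ∀ m, n < m → 0 < q.serviceRate (d m)) {m : ℕ}
    (hm : n ≤ m) : 0 < p m := by
  obtain ⟨i, hi⟩ := hne
  have hni : n ≤ i := not_lt.1 fun h => hi.ne' (hp.eq_zero_of_lt hidle h)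
  refine lt_of_le_of_ne (hp0 m) fun h => hi.ne' ?_
  rw [hp.eq_zero_iff_of_le hserve hni, ← hp.eq_zero_iff_of_le hserve hm, h]

end Balanced

/-! ### Occupation times -/

/-- The expected time that the process under the policy `d`, started in the state `n`, spends in
the state `m` up to the time `T`. -/
noncomputable def occTime (q : GroupServerQueue K) (d : ℕ → Fin K → ℕ) (T : ℝ) (n m : ℕ) : ℝ :=
  ∫ t in (0 : ℝ)..T, q.transProb d t n m

theorem le_costRate (q : GroupServerQueue K) (n : ℕ) (a : Fin K → ℕ) : q.h n ≤ q.costRate n a :=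
  le_add_of_nonneg_right (sum_nonneg fun k _ => mul_nonneg (Nat.cast_nonneg _) (q.c_nonneg k))

theorem exists_le_costRate (q : GroupServerQueue K) (x : ℝ) :
    ∃ N, ∀ m, N ≤ m → ∀ a : Fin K → ℕ, x ≤ q.costRate m a := by
  obtain ⟨N, hN⟩ := (q.h_tendsto.eventually_ge_atTop x).exists_forall_of_atTop
  exact ⟨N, fun m hm a => (hN m hm).trans (q.le_costRate m a)⟩

namespace IsEfficient

theorem occTime_nonneg (hd : q.IsEfficient d) {T : ℝ} (hT : 0 ≤ T) (n m : ℕ) :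
    0 ≤ q.occTime d T n m :=
  intervalIntegral.integral_nonneg hT fun _ ht => hd.transProb_nonneg ht.1 n m

theorem hasSum_occTime_mul_of_nonneg (hd : q.IsEfficient d) {T : ℝ} (hT : 0 ≤ T) {n : ℕ}
    {u : ℕ → ℝ} (hu : ∀ m, 0 ≤ u m) {e : ℝ → ℝ}
    (he : IntervalIntegrable e MeasureTheory.volume 0 T)
    (hsum : ∀ t, 0 ≤ t → HasSum (fun m => q.transProb d t n m * u m) (e t)) :
    HasSum (fun m => q.occTime d T n m * u m) (∫ t in (0 : ℝ)..T, e t) := by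
  have hmem : ∀ t ∈ Set.uIoc 0 T, 0 ≤ t := fun t ht => by
    rw [Set.uIoc_of_le hT] at ht
    exact ht.1.le
  have h := intervalIntegral.hasSum_integral_of_dominated_convergence
    (μ := MeasureTheory.volume) (F := fun m t => q.transProb d t n m * u m)
    (fun m t => q.transProb d t n m * u m)
    (fun m => ((hd.continuous_transProb n m).mul continuous_const).aestronglyMeasurable)
    (fun m => .of_forall fun t ht => (Real.norm_of_nonneg
      (mul_nonneg (hd.transProb_nonneg (hmem t ht) n m) (hu m))).le)
    (.of_forall fun t ht => (hsum t (hmem t ht)).summable)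
    (he.congr fun t ht => (hsum t (hmem t ht)).tsum_eq.symm)
    (.of_forall fun t ht => hsum t (hmem t ht))
  simp only [intervalIntegral.integral_mul_const] at h
  exact h

theorem hasSum_occTime (hd : q.IsEfficient d) {T : ℝ} (hT : 0 ≤ T) (n : ℕ) :
    HasSum (fun m => q.occTime d T n m) T := by
  have h := hd.hasSum_occTime_mul_of_nonneg (n := n) (u := fun _ => 1) (e := fun _ => 1) hT
    (fun _ => zero_le_one) intervalIntegrable_const
    fun t ht => by simpa using hd.hasSum_transProb ht n
  simpa using h

theorem hasSum_occTime_mul_costRate (hd : q.IsEfficient d) {T : ℝ} (hT : 0 ≤ T) {n : ℕ}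
    (hsum : ∀ t, 0 ≤ t → Summable fun m => q.transProb d t n m * q.costRate m (d m))
    (hint : IntervalIntegrable (fun t => q.expCost d t n) MeasureTheory.volume 0 T) :
    HasSum (fun m => q.occTime d T n m * q.costRate m (d m))
      (∫ t in (0 : ℝ)..T, q.expCost d t n) := by
  have hexcess : HasSum (fun m => q.occTime d T n m * (q.costRate m (d m) - q.h 0))
      (∫ t in (0 : ℝ)..T, (q.expCost d t n - q.h 0)) :=
    hd.hasSum_occTime_mul_of_nonneg hT
      (fun m => sub_nonneg.2 ((q.h_mono m.zero_le).trans (q.le_costRate m _)))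
      (hint.sub intervalIntegrable_const) fun t ht => by
        have hsub := (hsum t ht).hasSum.sub ((hd.hasSum_transProb ht n).mul_right (q.h 0))
        simp only [← mul_sub, one_mul] at hsub
        exact hsub
  rw [intervalIntegral.integral_sub hint intervalIntegrable_const] at hexcess
  simpa [mul_sub] using hexcess.add ((hd.hasSum_occTime hT n).mul_right (q.h 0))

theorem abs_occTime_balance_le_one (hd : q.IsEfficient d) {T : ℝ} (hT : 0 ≤ T) (n m : ℕ) :
    |q.serviceRate (d (m + 1)) * q.occTime d T n (m + 1) - q.arr * q.occTime d T n m| ≤ 1 := by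
  have hmass : ∀ t, 0 ≤ t → ∑ i ∈ range (m + 1), q.transProb d t n i ∈ Set.Icc (0 : ℝ) 1 :=
    fun t ht => ⟨sum_nonneg fun i _ => hd.transProb_nonneg ht n i,
      sum_le_hasSum _ (fun i _ => hd.transProb_nonneg ht n i) (hd.hasSum_transProb ht n)⟩
  have hup := (hd.intervalIntegrable_transProb n (m + 1) 0 T).const_mul (q.serviceRate (d (m + 1)))
  have hdown := (hd.intervalIntegrable_transProb n m 0 T).const_mul q.arr
  have hflow := intervalIntegral.integral_eq_sub_of_hasDerivAt
    (fun t _ => hd.hasDerivAt_sum_transProb t n m) (hup.sub hdown)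
  rw [intervalIntegral.integral_sub hup hdown, intervalIntegral.integral_const_mul,
    intervalIntegral.integral_const_mul] at hflow
  rw [occTime, occTime, hflow]
  exact abs_sub_le_of_nonneg_of_le (hmass T hT).1 (hmass T hT).2 (hmass 0 le_rfl).1
    (hmass 0 le_rfl).2

theorem sum_generator_mul_occTime (hd : q.IsEfficient d) (T : ℝ) (n m : ℕ) :
    ∑ l ∈ range (n + 2), q.generator d n l * q.occTime d T l m
      = q.transProb d T n m - if n = m then 1 else 0 := by
  have hint : ∀ l, IntervalIntegrable (fun t => q.generator d n l * q.transProb d t l m)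
      MeasureTheory.volume 0 T :=
    fun l => (hd.intervalIntegrable_transProb l m 0 T).const_mul _
  rw [← transProb_zero (q := q) (d := d) n m, ← intervalIntegral.integral_eq_sub_of_hasDerivAt
    (fun t _ => hd.hasDerivAt_transProb_backward t n m)
      ((continuous_finsetSum _ fun l _ =>
        continuous_const.mul (hd.continuous_transProb l m)).intervalIntegrable 0 T),
    intervalIntegral.integral_finsetSum fun l _ => hint l]
  exact sum_congr rfl fun l _ => (intervalIntegral.integral_const_mul _ _).symm

theorem exists_tendsto_occTime_div (hd : q.IsEfficient d) (n : ℕ) {U : Ultrafilter ℝ}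
    (hU : (U : Filter ℝ) ≤ atTop) :
    ∃ p : ℕ → ℝ, (∀ m, Tendsto (fun T => q.occTime d T n m / T) U (𝓝 (p m))) ∧ (∀ m, 0 ≤ p m) ∧
      q.Balanced d p := by
  have hT : ∀ᶠ T in (U : Filter ℝ), 0 < T := hU (eventually_gt_atTop 0)
  have hlim : ∀ m, ∃ x ∈ Set.Icc (0 : ℝ) 1,
      Tendsto (fun T => q.occTime d T n m / T) U (𝓝 x) := fun m =>
    isCompact_Icc.ultrafilter_le_nhds' (U.map fun T => q.occTime d T n m / T) <|
      hT.mono fun T hT => ⟨div_nonneg (hd.occTime_nonneg hT.le n m) hT.le,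
        (div_le_one hT).2 (le_hasSum (hd.hasSum_occTime hT.le n) m fun i _ =>
          hd.occTime_nonneg hT.le n i)⟩
  choose p hp hlim using hlim
  refine ⟨p, hlim, fun m => (hp m).1, fun m => ?_⟩
  have hbalance := (((hlim (m + 1)).const_mul (q.serviceRate (d (m + 1)))).sub
    ((hlim m).const_mul q.arr)).abs
  have hinv : Tendsto (fun T : ℝ => T⁻¹) U (𝓝 0) := tendsto_inv_atTop_zero.mono_left hU
  have hle := le_of_tendsto_of_tendsto hbalance hinv <| hT.mono fun T hT => by
    beta_reduce
    rw [← mul_div_assoc, ← mul_div_assoc, ← sub_div, abs_div, abs_of_pos hT, ← one_div]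
    exact div_le_div_of_nonneg_right (hd.abs_occTime_balance_le_one hT.le n m) hT.le
  exact (sub_eq_zero.1 (abs_nonpos_iff.1 hle)).symm

end IsEfficient

/-! ### Average cost and stationary weights -/

variable {η : ℝ}

namespace HasAverageCost

theorem hasSum_occTime_mul_costRate (h : q.HasAverageCost d η) (hd : q.IsEfficient d) {T : ℝ}
    (hT : 0 ≤ T) (n : ℕ) :
    HasSum (fun m => q.occTime d T n m * q.costRate m (d m))
      (∫ t in (0 : ℝ)..T, q.expCost d t n) :=
  hd.hasSum_occTime_mul_costRate hT (h n).1 ((h n).2.1 T hT)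

theorem sum_mul_costRate_sub_le (h : q.HasAverageCost d η) (hd : q.IsEfficient d) {n : ℕ}
    {l : Filter ℝ} [l.NeBot] (hl : l ≤ atTop) {p : ℕ → ℝ}
    (hp : ∀ m, Tendsto (fun T => q.occTime d T n m / T) l (𝓝 (p m))) {x : ℝ} {N : ℕ}
    (hx : ∀ m, N ≤ m → x ≤ q.costRate m (d m)) :
    ∑ m ∈ range N, p m * (q.costRate m (d m) - x) ≤ η - x := by
  have hsum : Tendsto (fun T => ∑ m ∈ range N, q.occTime d T n m / T * (q.costRate m (d m) - x)) l
      (𝓝 (∑ m ∈ range N, p m * (q.costRate m (d m) - x))) :=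
    tendsto_finsetSum _ fun m _ => (hp m).mul_const _
  refine le_of_tendsto_of_tendsto hsum (((h n).2.2.mono_left hl).sub_const x) ?_
  filter_upwards [hl (eventually_gt_atTop 0)] with T hT
  have hexcess := (h.hasSum_occTime_mul_costRate hd hT.le n).sub
    ((hd.hasSum_occTime hT.le n).mul_right x)
  simp only [← mul_sub] at hexcess
  have hle := sum_le_hasSum (range N) (fun m hm => mul_nonneg (hd.occTime_nonneg hT.le n m)
    (sub_nonneg.2 (hx m (not_lt.1 (mt mem_range.2 hm))))) hexcess
  simp only [div_mul_eq_mul_div, ← sum_div]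
  rw [div_le_iff₀ hT, sub_mul, one_mul, div_mul_cancel₀ _ hT.ne', mul_comm x]
  exact hle

theorem exists_balanced (h : q.HasAverageCost d η) (hd : q.IsEfficient d) :
    ∃ p : ℕ → ℝ, q.Balanced d p ∧ (∀ m, 0 ≤ p m) ∧ (∃ m, 0 < p m) ∧ Summable p ∧
      ∃ S ≤ 0, HasSum (fun m => p m * (q.costRate m (d m) - η)) S := by
  have hU : ((Ultrafilter.of atTop : Ultrafilter ℝ) : Filter ℝ) ≤ atTop := Ultrafilter.of_le _
  obtain ⟨p, hlim, hp0, hp⟩ := hd.exists_tendsto_occTime_div 0 hU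
  refine ⟨p, hp, hp0, ?_, ?_, ?_⟩
  · by_contra! hneg
    obtain ⟨N, hN⟩ := q.exists_le_costRate (η + 1)
    have hle := h.sum_mul_costRate_sub_le hd hU hlim fun m hm => hN m hm _
    simp only [fun m => le_antisymm (hneg m) (hp0 m), zero_mul, sum_const_zero] at hle
    linarith
  · obtain ⟨S, -, hS⟩ := exists_hasSum_le_of_sum_range_le (N := 0) (c := 1) (fun m _ => hp0 m)
      fun M _ => le_of_tendsto (tendsto_finsetSum (range M) fun m _ => hlim m) <| by
        filter_upwards [hU (eventually_gt_atTop 0)] with T hT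
        rw [← sum_div, div_le_one hT]
        exact sum_le_hasSum _ (fun m _ => hd.occTime_nonneg hT.le 0 m) (hd.hasSum_occTime hT.le 0)
    exact hS.summable
  · obtain ⟨N, hN⟩ := q.exists_le_costRate η
    refine exists_hasSum_le_of_sum_range_le (N := N)
      (fun m hm => mul_nonneg (hp0 m) (sub_nonneg.2 (hN m hm _))) fun M hM => ?_
    rw [← sub_self η]
    exact h.sum_mul_costRate_sub_le hd hU hlim fun m hm => hN m (hM.trans hm) _

theorem expCost_sub_costRate (h : q.HasAverageCost d η) (hd : q.IsEfficient d) (n : ℕ) {T : ℝ}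
    (hT : 0 ≤ T) : q.expCost d T n - q.costRate n (d n)
      = ∑ l ∈ range (n + 2), q.generator d n l * ∫ t in (0 : ℝ)..T, q.expCost d t l := by
  have hstart : HasSum (fun m => (if n = m then 1 else 0) * q.costRate m (d m))
      (q.costRate n (d n)) := by
    simpa using hasSum_single (f := fun m => (if n = m then 1 else 0) * q.costRate m (d m)) n
      fun m hm => by rw [if_neg hm.symm, zero_mul]
  have hocc := hasSum_sum (s := range (n + 2)) fun l _ =>
    (h.hasSum_occTime_mul_costRate hd hT l).mul_left (q.generator d n l)
  refine (((h n).1 T hT).hasSum.sub hstart).unique (hocc.congr_fun fun m => ?_)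
  simp only [← mul_assoc, ← sum_mul, ← sub_mul, hd.sum_generator_mul_occTime]

end HasAverageCost

-- By the integrated backward equation the residual of the Poisson equation is the limit of
-- `expCost - η`, and that limit is `0` because the integral of `expCost - η` converges.
theorem IsPotential.solvesPoisson {g : ℕ → ℝ} (hg : q.IsPotential d η g) (hd : q.IsEfficient d)
    (h : q.HasAverageCost d η) : q.SolvesPoisson d η g := by
  intro n
  have hint : ∀ l T, 0 ≤ T → IntervalIntegrable (fun t => q.expCost d t l - η)
      MeasureTheory.volume 0 T := fun l T hT => ((h l).2.1 T hT).sub intervalIntegrable_const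
  refine eq_zero_of_tendsto_of_tendsto_integral (hint n) (hg n) ?_
  refine ((tendsto_finsetSum (range (n + 2)) fun l _ =>
    (hg l).const_mul (q.generator d n l)).const_add (q.costRate n (d n) - η)).congr' ?_
  filter_upwards [eventually_ge_atTop 0] with T hT
  have hsub : ∀ l, ∫ t in (0 : ℝ)..T, (q.expCost d t l - η)
      = (∫ t in (0 : ℝ)..T, q.expCost d t l) - T * η := fun l => by
    rw [intervalIntegral.integral_sub ((h l).2.1 T hT) intervalIntegrable_const]
    simp
  simp only [hsub, mul_sub, sum_sub_distrib, ← sum_mul, hd.sum_generator, zero_mul, sub_zero,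
    ← h.expCost_sub_costRate hd n hT]
  ring

namespace Balanced

variable {p : ℕ → ℝ}

theorem occTime_div_le (hp : q.Balanced d p) (hd : q.IsEfficient d) (hpos : ∀ m, 0 < p m) {T : ℝ}
    (hT : 0 < T) (n m : ℕ) : q.occTime d T n m / T ≤ p m / p n := by
  have hle := intervalIntegral.integral_mono_on (μ := MeasureTheory.volume) hT.le
    (hd.intervalIntegrable_transProb n m 0 T) intervalIntegrable_const
    fun t ht => hp.transProb_le hd hpos ht.1 n m
  rw [intervalIntegral.integral_const, sub_zero, smul_eq_mul] at hle
  exact (div_le_iff₀' hT).2 hle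

theorem tendsto_occTime_div (hp : q.Balanced d p) (hd : q.IsEfficient d) (hpos : ∀ m, 0 < p m)
    {Z : ℝ} (hZ : HasSum p Z) (n m : ℕ) :
    Tendsto (fun T => q.occTime d T n m / T) atTop (𝓝 (p m / Z)) := by
  rw [tendsto_iff_ultrafilter]
  intro U hU
  obtain ⟨p', hlim, -, hp'⟩ := hd.exists_tendsto_occTime_div n hU
  have hone : ∑' m, p' m = 1 := by
    refine tendsto_nhds_unique (tendsto_tsum_of_dominated_convergence
      (hZ.summable.div_const (p n)) hlim ?_) (tendsto_const_nhds.congr' ?_)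
    · filter_upwards [hU (eventually_gt_atTop 0)] with T hT m
      rw [Real.norm_of_nonneg (div_nonneg (hd.occTime_nonneg hT.le n m) hT.le)]
      exact hp.occTime_div_le hd hpos hT n m
    · filter_upwards [hU (eventually_gt_atTop 0)] with T hT
      rw [tsum_div_const, (hd.hasSum_occTime hT.le n).tsum_eq, div_self hT.ne']
  have hmass : p 0 = p' 0 * Z := by
    rw [← hZ.tsum_eq, ← tsum_mul_left, ← one_mul (p 0), ← hone, ← tsum_mul_right]
    exact tsum_congr (hp.mul_eq_mul hpos hp')
  have hZ0 : Z ≠ 0 := fun h => (hpos 0).ne' (by rw [hmass, h, mul_zero])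
  have hp'0 : p' 0 ≠ 0 := fun h => (hpos 0).ne' (by rw [hmass, h, zero_mul])
  have heq : p' m = p m / Z := by
    rw [eq_div_iff hZ0]
    refine mul_left_cancel₀ hp'0 ?_
    rw [← hp.mul_eq_mul hpos hp' m, hmass]
    ring
  exact heq ▸ hlim m

end Balanced

/-- The weights `p` are positive, of finite mass and invariant under the policy `d`, and their mean
cost rate is `η`.  They are not normalized. -/
structure IsStationary (q : GroupServerQueue K) (d : ℕ → Fin K → ℕ) (η : ℝ) (p : ℕ → ℝ) :
    Prop where
  balanced : q.Balanced d p
  pos : ∀ m, 0 < p m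
  summable : Summable p
  hasSum : HasSum (fun m => p m * (q.costRate m (d m) - η)) 0

namespace IsStationary

variable {p : ℕ → ℝ}

theorem hasSum_mul_costRate (hp : q.IsStationary d η p) :
    HasSum (fun m => p m * q.costRate m (d m)) ((∑' m, p m) * η) := by
  simpa only [zero_add, ← mul_add, sub_add_cancel] using
    hp.hasSum.add (hp.summable.hasSum.mul_right η)

theorem tsum_pos (hp : q.IsStationary d η p) : 0 < ∑' m, p m :=
  hp.summable.tsum_pos (fun m => (hp.pos m).le) 0 (hp.pos 0)

theorem norm_transProb_mul_le (hp : q.IsStationary d η p) (hd : q.IsEfficient d) {t : ℝ}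
    (ht : 0 ≤ t) (n m : ℕ) (x : ℝ) : ‖q.transProb d t n m * x‖ ≤ |p m * x| / p n := by
  rw [norm_mul, Real.norm_of_nonneg (hd.transProb_nonneg ht n m), abs_mul, abs_of_pos (hp.pos m),
    mul_div_right_comm]
  exact mul_le_mul_of_nonneg_right (hp.balanced.transProb_le hd hp.pos ht n m) (abs_nonneg x)

theorem continuousOn_expCost (hp : q.IsStationary d η p) (hd : q.IsEfficient d) (n : ℕ) :
    ContinuousOn (fun t => q.expCost d t n) (Set.Ici 0) :=
  continuousOn_tsum (fun m => ((hd.continuous_transProb n m).mul continuous_const).continuousOn)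
    (hp.hasSum_mul_costRate.summable.abs.div_const (p n))
    fun m _ ht => hp.norm_transProb_mul_le hd ht n m _

theorem tendsto_integral_expCost (hp : q.IsStationary d η p) (hd : q.IsEfficient d) {n : ℕ}
    (hocc : ∀ T, 0 ≤ T → HasSum (fun m => q.occTime d T n m * q.costRate m (d m))
      (∫ t in (0 : ℝ)..T, q.expCost d t n)) :
    Tendsto (fun T : ℝ => 1 / T * ∫ t in (0 : ℝ)..T, q.expCost d t n) atTop (𝓝 η) := by
  have hcost := hp.hasSum_mul_costRate
  have hmean : ∑' m, p m / (∑' m, p m) * q.costRate m (d m) = η := by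
    simp only [div_mul_eq_mul_div]
    rw [tsum_div_const, hcost.tsum_eq, mul_div_cancel_left₀ _ hp.tsum_pos.ne']
  have hlim := tendsto_tsum_of_dominated_convergence (hcost.summable.abs.div_const (p n))
    (fun m => (hp.balanced.tendsto_occTime_div hd hp.pos hp.summable.hasSum n m).mul_const
      (q.costRate m (d m))) <| by
      filter_upwards [eventually_gt_atTop 0] with T hT m
      rw [norm_mul, Real.norm_of_nonneg (div_nonneg (hd.occTime_nonneg hT.le n m) hT.le), abs_mul,
        abs_of_pos (hp.pos m), mul_div_right_comm]
      exact mul_le_mul_of_nonneg_right (hp.balanced.occTime_div_le hd hp.pos hT n m) (abs_nonneg _)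
  rw [hmean] at hlim
  refine hlim.congr' ?_
  filter_upwards [eventually_ge_atTop 0] with T hT
  simp only [div_mul_eq_mul_div, one_mul]
  rw [tsum_div_const, (hocc T hT).tsum_eq]

theorem hasAverageCost (hp : q.IsStationary d η p) (hd : q.IsEfficient d) :
    q.HasAverageCost d η := by
  intro n
  have hsum : ∀ t, 0 ≤ t → Summable fun m => q.transProb d t n m * q.costRate m (d m) :=
    fun t ht => .of_norm_bounded (hp.hasSum_mul_costRate.summable.abs.div_const (p n))
      fun m => hp.norm_transProb_mul_le hd ht n m _
  have hint : ∀ T, 0 ≤ T →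
      IntervalIntegrable (fun t => q.expCost d t n) MeasureTheory.volume 0 T := fun T hT =>
    ((hp.continuousOn_expCost hd n).mono
      (Set.uIcc_of_le hT ▸ Set.Icc_subset_Ici_self)).intervalIntegrable
  exact ⟨hsum, hint, hp.tendsto_integral_expCost hd fun T hT =>
    hd.hasSum_occTime_mul_costRate hT hsum (hint T hT)⟩

theorem h_zero_le (hp : q.IsStationary d η p) : q.h 0 ≤ η := by
  have hle := hasSum_le (fun m => mul_le_mul_of_nonneg_left
    ((q.h_mono m.zero_le).trans (q.le_costRate m (d m))) (hp.pos m).le)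
    (hp.summable.hasSum.mul_right (q.h 0)) hp.hasSum_mul_costRate
  exact le_of_mul_le_mul_left hle hp.tsum_pos

end IsStationary

/-! ### Rewards and the exchange of servers -/

/-- The rate at which the action `a` earns money if each completed service earns `x` and the
operating costs are paid. -/
noncomputable def reward (q : GroupServerQueue K) (a : Fin K → ℕ) (x : ℝ) : ℝ :=
  ∑ k, (a k : ℝ) * (q.mu k * x - q.c k)

theorem costRate_eq_sub_reward (q : GroupServerQueue K) (n : ℕ) (a : Fin K → ℕ) (x : ℝ) :
    q.costRate n a = q.h n + q.serviceRate a * x - q.reward a x := by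
  rw [costRate, serviceRate, reward, sum_mul, add_sub_assoc, ← sum_sub_distrib]
  exact congrArg _ (sum_congr rfl fun k _ => by ring)

theorem reward_zero (q : GroupServerQueue K) (x : ℝ) : q.reward 0 x = 0 := by simp [reward]

theorem reward_mono (q : GroupServerQueue K) (a : Fin K → ℕ) : Monotone (q.reward a) :=
  fun _ _ hxy => sum_le_sum fun k _ => mul_le_mul_of_nonneg_left
    (sub_le_sub_right (mul_le_mul_of_nonneg_left hxy (q.mu_pos k).le) _) (Nat.cast_nonneg _)

theorem reward_add (q : GroupServerQueue K) (a b : Fin K → ℕ) (x : ℝ) :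
    q.reward (a + b) x = q.reward a x + q.reward b x := by
  simp only [reward, Pi.add_apply, Nat.cast_add, add_mul, sum_add_distrib]

theorem reward_single (q : GroupServerQueue K) (k : Fin K) (j : ℕ) (x : ℝ) :
    q.reward (Pi.single k j) x = j * (q.mu k * x - q.c k) := by
  rw [reward, sum_eq_single k] <;> simp +contextual

/-- The actions that an efficient policy may take in the state `n`. -/
def actions (q : GroupServerQueue K) (n : ℕ) : Finset (Fin K → ℕ) :=
  (Fintype.piFinset fun k => range (q.M k + 1)).filter fun a => ∑ k, a k ≤ n

theorem mem_actions {n : ℕ} {a : Fin K → ℕ} :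
    a ∈ q.actions n ↔ (∀ k, a k ≤ q.M k) ∧ ∑ k, a k ≤ n := by
  simp only [actions, mem_filter, Fintype.mem_piFinset, mem_range, Nat.lt_succ_iff]

theorem single_mem_actions {k : Fin K} {j n : ℕ} (hM : j ≤ q.M k) (hn : j ≤ n) :
    Pi.single k j ∈ q.actions n := by
  refine mem_actions.2 ⟨fun i => ?_, by simpa using hn⟩
  rcases eq_or_ne i k with rfl | hi
  · simpa using hM
  · simp [hi]

theorem zero_mem_actions (q : GroupServerQueue K) (n : ℕ) : 0 ∈ q.actions n :=
  mem_actions.2 ⟨fun _ => Nat.zero_le _, by simp⟩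

theorem exists_exchange_of_mem_actions {n m : ℕ} (hnm : n ≤ m) {a b : Fin K → ℕ}
    (ha : a ∈ q.actions (m + 1)) (hb : b ∈ q.actions n) :
    ∃ a' ∈ q.actions m, ∃ b' ∈ q.actions (n + 1), ∀ x y, x ≤ y →
      q.reward a x + q.reward b y ≤ q.reward a' x + q.reward b' y := by
  rw [mem_actions] at ha hb
  rcases Nat.lt_or_ge m (∑ k, a k) with hlt | hle
  · obtain ⟨k, -, hk⟩ := exists_lt_of_sum_lt (hb.2.trans_lt (hnm.trans_lt hlt))
    obtain ⟨a', rfl⟩ : ∃ a', a = a' + Pi.single k 1 :=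
      ⟨a - Pi.single k 1, (tsub_add_cancel_of_le fun i => by
        rcases eq_or_ne i k with rfl | hi
        · simpa using Nat.one_le_of_lt hk
        · simp [hi]).symm⟩
    have hsum : ∀ a : Fin K → ℕ, ∑ i, (a + Pi.single k 1 : Fin K → ℕ) i = ∑ i, a i + 1 :=
      fun a => by simp [sum_add_distrib]
    refine ⟨a', mem_actions.2 ⟨fun i => (Nat.le_add_right _ _).trans (ha.1 i), ?_⟩,
      b + Pi.single k 1, mem_actions.2 ⟨fun i => ?_, ?_⟩, fun x y hxy => ?_⟩
    · exact Nat.le_of_succ_le_succ ((hsum a').symm.trans_le ha.2)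
    · rcases eq_or_ne i k with rfl | hi
      · simpa using (Nat.succ_le_of_lt hk).trans (ha.1 i)
      · simpa [hi] using hb.1 i
    · exact (hsum b).trans_le (Nat.succ_le_succ hb.2)
    · have hmono := q.reward_mono (Pi.single k 1) hxy
      rw [reward_add, reward_add]
      linarith
  · exact ⟨a, mem_actions.2 ⟨ha.1, hle⟩, b, mem_actions.2 ⟨hb.1, hb.2.trans n.le_succ⟩,
      fun _ _ _ => le_rfl⟩

/-- The largest reward that can be earned in the state `n` if each completed service earns `x`. -/
noncomputable def maxReward (q : GroupServerQueue K) (n : ℕ) (x : ℝ) : ℝ :=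
  (q.actions n).sup' ⟨0, q.zero_mem_actions n⟩ fun a => q.reward a x

theorem reward_le_maxReward {n : ℕ} {a : Fin K → ℕ} (ha : a ∈ q.actions n) (x : ℝ) :
    q.reward a x ≤ q.maxReward n x :=
  le_sup' (fun a => q.reward a x) ha

theorem exists_maxReward_eq (q : GroupServerQueue K) (n : ℕ) (x : ℝ) :
    ∃ a ∈ q.actions n, q.maxReward n x = q.reward a x :=
  exists_mem_eq_sup' _ _

theorem maxReward_mono (q : GroupServerQueue K) (n : ℕ) : Monotone (q.maxReward n) :=
  fun _ _ hxy => sup'_mono_fun fun a _ => q.reward_mono a hxy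

theorem maxReward_add_maxReward_le (q : GroupServerQueue K) {n m : ℕ} (hnm : n ≤ m) {x y : ℝ}
    (hxy : x ≤ y) :
    q.maxReward (m + 1) x + q.maxReward n y ≤ q.maxReward m x + q.maxReward (n + 1) y := by
  obtain ⟨a, ha, hax⟩ := q.exists_maxReward_eq (m + 1) x
  obtain ⟨b, hb, hby⟩ := q.exists_maxReward_eq n y
  obtain ⟨a', ha', b', hb', hle⟩ := exists_exchange_of_mem_actions hnm ha hb
  rw [hax, hby]
  exact (hle x y hxy).trans (add_le_add (reward_le_maxReward ha' x) (reward_le_maxReward hb' y))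

theorem exists_reward_div_nonpos {n : ℕ} {b : Fin K → ℕ} (hb : b ∈ q.actions n)
    (hpos : 0 < q.serviceRate b) :
    ∃ k, 0 < q.M k ∧ ∀ m, ∀ a ∈ q.actions m, q.reward a (q.c k / q.mu k) ≤ 0 := by
  have hne : (univ.filter fun k => 0 < q.M k).Nonempty := by
    by_contra h
    rw [not_nonempty_iff_eq_empty, filter_eq_empty_iff] at h
    have hb0 : b = 0 := funext fun k =>
      Nat.le_zero.1 (((mem_actions.1 hb).1 k).trans (not_lt.1 (h (mem_univ k))))
    rw [hb0, serviceRate_zero] at hpos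
    exact hpos.false
  obtain ⟨k, hk, hmin⟩ := exists_min_image _ (fun k => q.c k / q.mu k) hne
  refine ⟨k, (mem_filter.1 hk).2, fun m a ha => sum_nonpos fun i _ => ?_⟩
  rcases Nat.eq_zero_or_pos (a i) with hi | hi
  · simp [hi]
  · have hle := hmin i (mem_filter.2 ⟨mem_univ i, hi.trans_le ((mem_actions.1 ha).1 i)⟩)
    rw [le_div_iff₀' (q.mu_pos i)] at hle
    exact mul_nonpos_of_nonneg_of_nonpos (Nat.cast_nonneg _) (sub_nonpos.2 hle)

/-! ### Changing a policy in finitely many states -/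

/-- The weights that agree with `p` from the state `n` on and are continued below `n` so as to be
balanced for the policy `d`; `p` itself need only be balanced from `n` on. -/
noncomputable def balancedBelow (q : GroupServerQueue K) (d : ℕ → Fin K → ℕ) (n : ℕ) (p : ℕ → ℝ)
    (m : ℕ) : ℝ :=
  p (max m n) * ∏ i ∈ Ico m n, q.serviceRate (d (i + 1)) / q.arr

section balancedBelow

variable {n : ℕ} {p : ℕ → ℝ}

theorem balancedBelow_of_le {m : ℕ} (hm : n ≤ m) : q.balancedBelow d n p m = p m := by
  rw [balancedBelow, max_eq_left hm, Ico_eq_empty_of_le hm, prod_empty, mul_one]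

theorem balanced_balancedBelow
    (hp : ∀ m, n ≤ m → q.arr * p m = q.serviceRate (d (m + 1)) * p (m + 1)) :
    q.Balanced d (q.balancedBelow d n p) := by
  intro m
  rcases lt_or_ge m n with hm | hm
  · have harr := q.arr_pos.ne'
    rw [balancedBelow, balancedBelow, max_eq_right hm.le, max_eq_right hm,
      prod_eq_prod_Ico_succ_bot hm]
    field_simp
  · rw [balancedBelow_of_le hm, balancedBelow_of_le (hm.trans m.le_succ), hp m hm]

theorem balancedBelow_nonneg (hp : ∀ m, 0 ≤ p m) (m : ℕ) : 0 ≤ q.balancedBelow d n p m :=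
  mul_nonneg (hp _) (prod_nonneg fun _ _ => div_nonneg (q.serviceRate_nonneg _) q.arr_pos.le)

theorem balancedBelow_pos (hp : ∀ m, n ≤ m → 0 < p m)
    (hd : ∀ m, 0 < m → 0 < q.serviceRate (d m)) (m : ℕ) : 0 < q.balancedBelow d n p m :=
  mul_pos (hp _ (le_max_right m n)) (prod_pos fun i _ => div_pos (hd _ i.succ_pos) q.arr_pos)

theorem summable_balancedBelow (hp : Summable p) : Summable (q.balancedBelow d n p) :=
  (hasSum_of_eqOn_Ici hp.hasSum fun _ => balancedBelow_of_le).summable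

end balancedBelow

/-! ### An optimal policy does not idle -/

variable {p : ℕ → ℝ}

theorem Balanced.hasSum_mul_sub_reward_iff (hp : q.Balanced d p) (hd : q.IsEfficient d)
    (hs : Summable p) (x S : ℝ) :
    HasSum (fun m => p m * (q.h m + q.arr * x - q.reward (d m) x - η)) S ↔
      HasSum (fun m => p m * (q.costRate m (d m) - η)) S := by
  have hzero : HasSum (fun m => (p m * q.serviceRate (d m) - q.arr * p m) * x) 0 := by
    have hdiff := (hp.hasSum_mul_serviceRate hd hs.hasSum).sub (hs.hasSum.mul_left q.arr)
    simpa using hdiff.mul_right x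
  simp only [q.costRate_eq_sub_reward _ _ x]
  refine ⟨fun h => ?_, fun h => ?_⟩
  · simpa using (h.add hzero).congr_fun fun m => by ring
  · simpa using (h.sub hzero).congr_fun fun m => by ring

theorem Balanced.h_add_lt (hp : q.Balanced d p) (hd : q.IsEfficient d) (hs : Summable p) {n : ℕ}
    (hzero : ∀ m, m < n → p m = 0) (hpos : ∀ m, n ≤ m → 0 < p m) {S : ℝ} (hS0 : S ≤ 0)
    (hS : HasSum (fun m => p m * (q.costRate m (d m) - η)) S) {x : ℝ}
    (hx : ∀ m, q.reward (d m) x ≤ 0) : q.h n + q.arr * x < η := by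
  by_contra! hη
  have hnonneg : ∀ m, 0 ≤ p m * (q.h m + q.arr * x - q.reward (d m) x - η) := fun m => by
    rcases lt_or_ge m n with hm | hm
    · rw [hzero m hm, zero_mul]
    · exact mul_nonneg (hpos m hm).le (by linarith [hx m, q.h_mono hm])
  obtain ⟨N, hN⟩ := (q.h_tendsto.eventually_gt_atTop (q.h n)).exists
  have hnN : n ≤ N := le_of_not_gt fun h => (q.h_mono h.le).not_gt hN
  have hterm := le_hasSum ((hp.hasSum_mul_sub_reward_iff hd hs x S).2 hS) N fun m _ => hnonneg m
  exact ((mul_pos (hpos N hnN) (by linarith [hx N])).trans_le (hterm.trans hS0)).false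

/-- The policy that follows `d` above the state `n` and in the states `1`, ..., `n` turns on exactly
one server, of the group `k`. -/
def singleUpTo (d : ℕ → Fin K → ℕ) (k : Fin K) (n m : ℕ) : Fin K → ℕ :=
  if n < m then d m else Pi.single k (min m 1)

theorem singleUpTo_of_lt {k : Fin K} {n m : ℕ} (hm : n < m) : singleUpTo d k n m = d m :=
  if_pos hm

theorem singleUpTo_of_le {k : Fin K} {n m : ℕ} (hm : m ≤ n) :
    singleUpTo d k n m = Pi.single k (min m 1) :=
  if_neg hm.not_gt

theorem IsEfficient.singleUpTo (hd : q.IsEfficient d) {k : Fin K} (hk : 0 < q.M k) (n : ℕ) :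
    q.IsEfficient (singleUpTo d k n) := fun m => by
  rcases lt_or_ge n m with hm | hm
  · rw [singleUpTo_of_lt hm]
    exact hd m
  · rw [singleUpTo_of_le hm]
    exact mem_actions.1 (single_mem_actions ((min_le_right m 1).trans hk) (min_le_left m 1))

theorem serviceRate_singleUpTo_pos {k : Fin K} {n : ℕ}
    (hserve : ∀ m, n < m → 0 < q.serviceRate (d m)) {m : ℕ} (hm : 0 < m) :
    0 < q.serviceRate (singleUpTo d k n m) := by
  rcases lt_or_ge n m with hnm | hnm
  · rw [singleUpTo_of_lt hnm]
    exact hserve m hnm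
  · rw [singleUpTo_of_le hnm, min_eq_right hm]
    exact sum_pos' (fun i _ => mul_nonneg (Nat.cast_nonneg _) (q.mu_pos i).le)
      ⟨k, mem_univ k, by simpa using q.mu_pos k⟩

theorem reward_singleUpTo_div (q : GroupServerQueue K) {k : Fin K} {n m : ℕ} (hm : m ≤ n) :
    q.reward (singleUpTo d k n m) (q.c k / q.mu k) = 0 := by
  rw [singleUpTo_of_le hm, reward_single, mul_div_cancel₀ _ (q.mu_pos k).ne', sub_self, mul_zero]

theorem eq_zero_of_serviceRate_eq_zero {a : Fin K → ℕ} (h : q.serviceRate a = 0) : a = 0 := by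
  funext k
  have hk := (sum_eq_zero_iff_of_nonneg fun k _ =>
    mul_nonneg (Nat.cast_nonneg (a k)) (q.mu_pos k).le).1 h k (mem_univ k)
  simpa [(q.mu_pos k).ne'] using hk

namespace IsOptimal

variable {d' : ℕ → Fin K → ℕ} {S : ℝ}

theorem nonneg_of_pos (hopt : q.IsOptimal d η) (hd' : q.IsEfficient d') (hp : q.Balanced d' p)
    (hpos : ∀ m, 0 < p m) (hs : Summable p)
    (hS : HasSum (fun m => p m * (q.costRate m (d' m) - η)) S) : 0 ≤ S := by
  have hmass : 0 < ∑' m, p m := hs.tsum_pos (fun m => (hpos m).le) 0 (hpos 0)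
  have hstat : q.IsStationary d' (η + S / ∑' m, p m) p := by
    refine ⟨hp, hpos, hs, ?_⟩
    have h := hS.sub (hs.hasSum.mul_right (S / ∑' m, p m))
    rw [mul_div_cancel₀ _ hmass.ne', sub_self] at h
    exact h.congr_fun fun m => by ring
  have hη := hopt.2.2 d' _ hd' (hstat.hasAverageCost hd')
  have hquot := (le_add_iff_nonneg_right η).1 hη
  rwa [le_div_iff₀ hmass, zero_mul] at hquot

-- The states below `n` are transient.  Let the cheapest server `k` work up to `n` instead, so that
-- they become recurrent: as services at the price `x = c k / mu k` bring the server no net reward,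
-- a state `m ≤ n` costs `h m + arr * x`, which is less than `η` if `S ≤ 0`, so the mean cost would
-- fall below the optimum.
theorem pos_of_idle (hopt : q.IsOptimal d η) (hd' : q.IsEfficient d') (hp : q.Balanced d' p)
    (hp0 : ∀ m, 0 ≤ p m) (hne : ∃ m, 0 < p m) (hs : Summable p)
    (hS : HasSum (fun m => p m * (q.costRate m (d' m) - η)) S) {n : ℕ} (hn : 0 < n)
    (hidle : q.serviceRate (d' n) = 0) (hserve : ∀ m, n < m → 0 < q.serviceRate (d' m)) :
    0 < S := by
  by_contra! hS0
  have hzero : ∀ m, m < n → p m = 0 := fun m hm => hp.eq_zero_of_lt hidle hm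
  have hpos : ∀ m, n ≤ m → 0 < p m := fun m hm => hp.pos_of_le hp0 hne hidle hserve hm
  obtain ⟨k, hk, hcheap⟩ := exists_reward_div_nonpos (mem_actions.2 (hd' (n + 1)))
    (hserve _ n.lt_succ_self)
  set x := q.c k / q.mu k
  have hη : q.h n + q.arr * x < η :=
    hp.h_add_lt hd' hs hzero hpos hS0 hS fun m => hcheap m _ (mem_actions.2 (hd' m))
  set e := singleUpTo d' k n with he
  set p' := q.balancedBelow e n p with hp'
  have hp'bal : q.Balanced e p' := balanced_balancedBelow fun m hm => by
    rw [he, singleUpTo_of_lt (Nat.lt_succ_of_le hm), hp m]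
  have hp'pos : ∀ m, 0 < p' m :=
    balancedBelow_pos hpos fun m hm => serviceRate_singleUpTo_pos hserve hm
  have hp's : Summable p' := summable_balancedBelow hs
  have heff : q.IsEfficient e := hd'.singleUpTo hk n
  have hS' := hasSum_of_eqOn_Ici (n := n)
    (v := fun m => p' m * (q.h m + q.arr * x - q.reward (e m) x - η))
    ((hp.hasSum_mul_sub_reward_iff hd' hs x S).2 hS) fun m hm => by
      rcases hm.eq_or_lt with rfl | hm
      · rw [hp', balancedBelow_of_le le_rfl, reward_singleUpTo_div q le_rfl,
          eq_zero_of_serviceRate_eq_zero hidle, reward_zero]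
      · rw [hp', balancedBelow_of_le hm.le, he, singleUpTo_of_lt hm]
  have hneg : ∑ m ∈ range n, (p' m * (q.h m + q.arr * x - q.reward (e m) x - η)
      - p m * (q.h m + q.arr * x - q.reward (d' m) x - η)) < 0 :=
    sum_neg (fun m hm => by
      have hm := mem_range.1 hm
      rw [hzero m hm, zero_mul, sub_zero, reward_singleUpTo_div q hm.le]
      exact mul_neg_of_pos_of_neg (hp'pos m) (by linarith [q.h_mono hm.le])) ⟨0, mem_range.2 hn⟩
  have hnonneg := hopt.nonneg_of_pos heff hp'bal hp'pos hp's
    ((hp'bal.hasSum_mul_sub_reward_iff heff hp's x _).1 hS')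
  linarith

theorem nonneg_of_balanced (hopt : q.IsOptimal d η) (hd' : q.IsEfficient d')
    (hp : q.Balanced d' p) (hp0 : ∀ m, 0 ≤ p m) (hne : ∃ m, 0 < p m) (hs : Summable p)
    (hS : HasSum (fun m => p m * (q.costRate m (d' m) - η)) S) :
    0 ≤ S ∧ ∀ n, 0 < n → q.serviceRate (d' n) = 0 → 0 < S := by
  classical
  obtain ⟨M, hM⟩ := hne
  set N := Nat.findGreatest (fun n => q.serviceRate (d' n) = 0) M
  have hidle : q.serviceRate (d' N) = 0 :=
    Nat.findGreatest_spec (P := fun n => q.serviceRate (d' n) = 0) M.zero_le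
      hd'.serviceRate_apply_zero
  have hlast : ∀ n, q.serviceRate (d' n) = 0 → n ≤ N := fun n hn =>
    Nat.le_findGreatest (not_lt.1 fun h => hM.ne' (hp.eq_zero_of_lt hn h)) hn
  have hserve : ∀ n, N < n → 0 < q.serviceRate (d' n) := fun n hn =>
    (q.serviceRate_nonneg _).lt_of_ne' fun h => hn.not_ge (hlast n h)
  have hpos : 0 < N → 0 < S := fun hN =>
    hopt.pos_of_idle hd' hp hp0 ⟨M, hM⟩ hs hS hN hidle hserve
  refine ⟨?_, fun n hn h => hpos (hn.trans_le (hlast n h))⟩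
  rcases N.eq_zero_or_pos with hN | hN
  · exact hopt.nonneg_of_pos hd' hp
      (fun m => hp.pos_of_le hp0 ⟨M, hM⟩ hidle hserve (hN ▸ m.zero_le)) hs hS
  · exact (hpos hN).le

theorem exists_isStationary (hopt : q.IsOptimal d η) : ∃ p, q.IsStationary d η p := by
  obtain ⟨p, hp, hp0, hne, hs, S, hS0, hS⟩ := hopt.2.1.exists_balanced hopt.1
  obtain ⟨hS0', hidle⟩ := hopt.nonneg_of_balanced hopt.1 hp hp0 hne hs hS
  have hserve : ∀ n, 0 < n → 0 < q.serviceRate (d n) := fun n hn =>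
    (q.serviceRate_nonneg _).lt_of_ne' fun h => (hidle n hn h).not_ge hS0
  exact ⟨p, hp, fun m => hp.pos_of_le hp0 hne hopt.1.serviceRate_apply_zero hserve m.zero_le, hs,
    le_antisymm hS0 hS0' ▸ hS⟩

end IsOptimal

/-! ### Policy improvement -/

variable {g : ℕ → ℝ}

theorem SolvesPoisson.arr_mul_prf (hg : q.SolvesPoisson d η g) (hd : q.IsEfficient d) (n : ℕ) :
    q.arr * prf g (n + 1) = η - q.h n + q.reward (d n) (prf g n) := by
  have hn := hg n
  rw [hd.sum_generator_mul, q.costRate_eq_sub_reward n (d n) (prf g n)] at hn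
  rw [prf, Nat.add_sub_cancel]
  rw [prf] at hn ⊢
  linarith

theorem SolvesPoisson.sum_mul_costRate_sub (hg : q.SolvesPoisson d η g) (hd : q.IsEfficient d)
    {d' : ℕ → Fin K → ℕ} (hd' : q.IsEfficient d') (hp : q.Balanced d' p) (n : ℕ) :
    ∑ m ∈ range (n + 1), p m * (q.costRate m (d' m) - η)
      = ∑ m ∈ range (n + 1), p m * (q.reward (d m) (prf g m) - q.reward (d' m) (prf g m))
        - q.arr * p n * prf g (n + 1) := by
  have hterm : ∀ m, p m * (q.costRate m (d' m) - η)
      = p m * (q.reward (d m) (prf g m) - q.reward (d' m) (prf g m))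
        + (q.serviceRate (d' m) * p m * prf g m - q.arr * p m * prf g (m + 1)) := fun m => by
    rw [mul_right_comm q.arr, hg.arr_mul_prf hd, q.costRate_eq_sub_reward m (d' m) (prf g m)]
    ring
  induction n with
  | zero =>
    rw [sum_range_one, sum_range_one, hterm, hd'.serviceRate_apply_zero]
    ring
  | succ n ih =>
    rw [sum_range_succ, ih, sum_range_succ _ (n + 1), hterm (n + 1), hp n]
    ring

theorem SolvesPoisson.bddBelow_range_prf (hg : q.SolvesPoisson d η g) (hd : q.IsEfficient d)
    (hp : q.IsStationary d η p) : BddBelow (Set.range (prf g)) := by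
  obtain ⟨N, hN⟩ := q.exists_le_costRate η
  refine Filter.IsBoundedUnder.bddBelow_range (isBoundedUnder_of_eventually_ge (a := 0) ?_)
  filter_upwards [eventually_gt_atTop N] with n hn
  obtain ⟨n, rfl⟩ := Nat.exists_eq_succ_of_ne_zero (Nat.ne_zero_of_lt hn)
  have htail := ((hasSum_nat_add_iff' (n + 1)).2 hp.hasSum).nonneg fun m =>
    mul_nonneg (hp.pos _).le (sub_nonneg.2 (hN (m + (n + 1)) (by omega) (d _)))
  rw [hg.sum_mul_costRate_sub hd hd hp.balanced] at htail
  simp only [sub_self, mul_zero, sum_const_zero, zero_sub, neg_neg] at htail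
  exact nonneg_of_mul_nonneg_right htail (mul_pos q.arr_pos (hp.pos n))

theorem IsEfficient.update (hd : q.IsEfficient d) {n : ℕ} {a : Fin K → ℕ} (ha : a ∈ q.actions n) :
    q.IsEfficient (Function.update d n a) := by
  intro m
  rcases eq_or_ne m n with rfl | hm
  · simpa using mem_actions.1 ha
  · simpa [hm] using hd m

namespace IsOptimal

theorem reward_le (hopt : q.IsOptimal d η) (hg : q.SolvesPoisson d η g)
    (hp : q.IsStationary d η p) {n : ℕ} {a : Fin K → ℕ} (ha : a ∈ q.actions n) :
    q.reward a (prf g n) ≤ q.reward (d n) (prf g n) := by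
  have hd := hopt.1
  set d' := Function.update d n a
  have hd'n : d' n = a := Function.update_self ..
  have hd'ne : ∀ m, m ≠ n → d' m = d m := fun m hm => Function.update_of_ne hm ..
  have hd'eff : q.IsEfficient d' := hd.update ha
  set p' := q.balancedBelow d' n p with hp'
  have hp'bal : q.Balanced d' p' := balanced_balancedBelow fun m hm => by
    rw [hd'ne _ (Nat.lt_succ_of_le hm).ne', hp.balanced m]
  have hp'n : p' n = p n := balancedBelow_of_le le_rfl
  have hS' := hasSum_of_eqOn_Ici (n := n + 1) (v := fun m => p' m * (q.costRate m (d' m) - η))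
    hp.hasSum fun m hm => by
      rw [hp', balancedBelow_of_le (n.le_succ.trans hm), hd'ne m (Nat.lt_of_succ_le hm).ne']
  have hbelow : ∑ m ∈ range n, p' m * (q.reward (d m) (prf g m) - q.reward (d' m) (prf g m)) = 0 :=
    sum_eq_zero fun m hm => by rw [hd'ne m (mem_range.1 hm).ne, sub_self, mul_zero]
  have hgain : ∑ m ∈ range (n + 1),
      (p' m * (q.costRate m (d' m) - η) - p m * (q.costRate m (d m) - η))
      = p n * (q.reward (d n) (prf g n) - q.reward a (prf g n)) := by
    rw [sum_sub_distrib, hg.sum_mul_costRate_sub hd hd'eff hp'bal,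
      hg.sum_mul_costRate_sub hd hd hp.balanced, sum_range_succ, hbelow, hp'n, hd'n]
    simp
  rw [zero_add, hgain] at hS'
  have hnonneg := (hopt.nonneg_of_balanced hd'eff hp'bal
    (balancedBelow_nonneg fun m => (hp.pos m).le) ⟨n, hp'n ▸ hp.pos n⟩
    (summable_balancedBelow hp.summable) hS').1
  exact sub_nonneg.1 (nonneg_of_mul_nonneg_right hnonneg (hp.pos n))

theorem reward_eq_maxReward (hopt : q.IsOptimal d η) (hg : q.SolvesPoisson d η g)
    (hp : q.IsStationary d η p) (n : ℕ) : q.reward (d n) (prf g n) = q.maxReward n (prf g n) :=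
  le_antisymm (reward_le_maxReward (mem_actions.2 (hopt.1 n)) _)
    (sup'_le _ _ fun _ ha => hopt.reward_le hg hp ha)

theorem monotone_prf (hopt : q.IsOptimal d η) (hg : q.SolvesPoisson d η g)
    (hp : q.IsStationary d η p) : Monotone (prf g) := by
  have hrec := hg.arr_mul_prf hopt.1
  have hconv : Monotone fun n => q.h (n + 1) - q.h n := monotone_nat_of_le_succ q.h_convex
  refine monotone_of_recursion (φ := fun n x => (η - q.h n + q.maxReward n x) / q.arr)
    (fun n => ?_) (fun n x y hxy => ?_) (fun {n m x y} hnm hxy => ?_) ?_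
    (hg.bddBelow_range_prf hopt.1 hp)
  · rw [eq_div_iff q.arr_pos.ne', mul_comm, hrec, hopt.reward_eq_maxReward hg hp]
  · exact div_le_div_of_nonneg_right (add_le_add_right (q.maxReward_mono n hxy) _) q.arr_pos.le
  · have hexchange := q.maxReward_add_maxReward_le hnm hxy
    have hh : q.h (n + 1) - q.h n ≤ q.h (m + 1) - q.h m := hconv hnm
    rw [← sub_div, ← sub_div]
    exact div_le_div_of_nonneg_right (by linarith) q.arr_pos.le
  · have hfirst := hrec 0
    rw [hopt.1.apply_zero, reward_zero, add_zero, zero_add] at hfirst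
    have hprf : prf g 0 = 0 := sub_self _
    exact hprf ▸ nonneg_of_mul_nonneg_right (hfirst ▸ sub_nonneg.2 hp.h_zero_le) q.arr_pos

end IsOptimal

end GroupServerQueue

theorem theorem5 {K : ℕ} (q : GroupServerQueue K) (d : ℕ → Fin K → ℕ) (η : ℝ)
    (hd : q.IsOptimal d η) (g : ℕ → ℝ)
    (hg : q.IsPotential d η g ∨ q.SolvesPoisson d η g) :
    (∀ n : ℕ, 1 ≤ n → 0 ≤ GroupServerQueue.prf g n) ∧
    (∀ n : ℕ, 1 ≤ n → GroupServerQueue.prf g n ≤ GroupServerQueue.prf g (n + 1)) := by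
  obtain ⟨p, hp⟩ := hd.exists_isStationary
  have hpoisson : q.SolvesPoisson d η g := hg.elim (fun h => h.solvesPoisson hd.1 hd.2.1) id
  have hmono : Monotone (GroupServerQueue.prf g) := hd.monotone_prf hpoisson hp
  have hzero : GroupServerQueue.prf g 0 = 0 := sub_self _
  exact ⟨fun n _ => hzero ▸ hmono n.zero_le, fun n _ => hmono n.le_succ⟩
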